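/- For $n\ge 1$ and $\mathbf c\in\mathbb R_{\ge 0}^n$ with $c_1+\cdots+c_n=n$, let $\mathrm{Mat}_n(\mathbf c)$ be the (non-empty) set of real $n\times n$ matrices with non-negative entries, all row sums equal to $1$, and $j$-th column sum equal to $c_j$ for every $j$. For $M\in\mathrm{Mat}_n(\mathbf c)$ let $p_M(\mathbf x)=\prod_{i=1}^n\sum_{j=1}^n m_{ij}x_j$ and let $$\mathrm{Cap}_{\mathbf 1}(p_M)=\inf_{x_1,\dots,x_n>0}\frac{p_M(\mathbf x)}{x_1\cdots x_n}$$ be its capacity. (1) For every $n\ge 1$ there is $\epsilon_n>0$ such that for every $\mathbf c\in\mathbb R_{\ge0}^n$ with $\sum_j c_j=n$ and $\|\mathbf c-\mathbf 1\|_1=\sum_j|c_j-1|<\epsilon_n$, the rank-one matrix $\frac1n\mathbf 1\,\mathbf c^\top$ is the unique minimizer of the permanent over $\mathrm{Mat}_n(\mathbf c)$. (2) Explicitly, let $n\ge 2$, let $\mathbf c\in\mathbb R_{\ge0}^n$ with $\sum_j c_j=n$, and let $L(\mathbf c)>0$ be any positive lower bound on the capacity over $\mathrm{Mat}_n(\mathbf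 c)$, that is, $\mathrm{Cap}_{\mathbf 1}(p_M)\ge L(\mathbf c)$ for all $M\in\mathrm{Mat}_n(\mathbf c)$. If $$\frac{c_1c_2\cdots c_n}{L(\mathbf c)}<\frac{(n-2)^{n-2}\,n^{n-1}}{(n-1)^{2n-3}}$$ (with $0^0=1$ when $n=2$), then $\frac1n\mathbf 1\,\mathbf c^\top$ is the unique minimizer of the permanent over $\mathrm{Mat}_n(\mathbf c)$. -/

import Mathlib

noncomputable section

namespace PermMin

/-- The set of `n × n` real matrices with non-negative entries, all row sums equal to `1`,
and `j`-th column sum equal to `c j`. -/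
def Mat {n : ℕ} (c : Fin n → ℝ) : Set (Matrix (Fin n) (Fin n) ℝ) :=
  {M | (∀ i j, 0 ≤ M i j) ∧ (∀ i, ∑ j, M i j = 1) ∧ (∀ j, ∑ i, M i j = c j)}

/-- The polynomial `∏ i, ∑ j, M i j * x j` associated to a matrix `M`. -/
def assocPoly {n : ℕ} (M : Matrix (Fin n) (Fin n) ℝ) : MvPolynomial (Fin n) ℝ :=
  ∏ i, ∑ j, MvPolynomial.C (M i j) * MvPolynomial.X j

/-- The capacity of a polynomial with non-negative coefficients: the infimum of `p x / x ^ κ`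
over all `x` with strictly positive coordinates. -/
def capacity {n : ℕ} (κ : Fin n → ℕ) (p : MvPolynomial (Fin n) ℝ) : ℝ :=
  ⨅ x : {x : Fin n → ℝ // ∀ i, 0 < x i}, MvPolynomial.eval x.1 p / ∏ i, x.1 i ^ κ i

/-- `a` is the one and only minimizer of `f` over `s`. -/
def IsUniqueMinimizer {α : Type*} (f : α → ℝ) (s : Set α) (a : α) : Prop :=
  a ∈ s ∧ IsMinOn f s a ∧ ∀ b ∈ s, IsMinOn f s b → b = a

/-- The rank-one matrix `(1 / n) • 1 cᵀ`. -/
def rankOne {n : ℕ} (c : Fin n → ℝ) : Matrix (Fin n) (Fin n) ℝ :=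
  (1 / (n : ℝ)) • Matrix.vecMulVec (1 : Fin n → ℝ) c

end PermMin

end

/-! ### The univariate capacity inequality. -/

namespace PermMin

/-! Both parts reduce to one fact: every minimizer has only positive entries.

Given that, `isUniqueMinimizer_of_pos` finishes. Mixing two rows with weight `t` changes the
permanent by `t * (1 - t) * D`; at a positive minimizer small `t` of both signs is allowed, so `D =
0` and mixing yields further minimizers. Averaging all rows but one reaches rows `v` and one row `v
+ w`. Spreading `w` over the other rows gives enough vanishing permanents to make the second
derivative of `∏ (v_j + X w_j)` zero. Since `∑ w_j = 0`, a nonzero `w` would give degree at least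
two; so `w = 0`.

Positivity comes from Gurvits' inequality. For a homogeneous stable polynomial, each extraction of a
linear coefficient costs a factor `capFactor` of the degree in that variable, and these telescope to
`n!/n^n`. A zero entry lowers the first degree from `n` to `n - 1`, and `capFactor` is strictly
decreasing, so the permanent is bounded below by a larger multiple of the capacity
(`le_permanent_of_entry_zero`). The hypothesis of (2) says exactly that this bound exceeds the
permanent of `rankOne c`. For (1), the capacity is at least 1 in the doubly stochastic case, and
compactness extends the strict inequality to nearby `c` (`exists_gap`). -/

/-- The factor `((k - 1) / k) ^ (k - 1)` in the univariate capacity inequality. -/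
noncomputable def capFactor (k : ℕ) : ℝ := (((k : ℝ) - 1) / k) ^ (k - 1)

/-- From `1 + x ≤ exp x`, each factor is at most `A * exp (z / A - 1)`. When `A` is the mean the
exponential disappears, leaving AM-GM. -/
lemma multiset_prod_le_exp {A : ℝ} (hA : 0 < A) (s : Multiset ℝ) (hs : ∀ z ∈ s, 0 ≤ z) :
    s.prod ≤ A ^ s.card * Real.exp (s.sum / A - s.card) := by
  induction s using Multiset.induction with
  | empty => simp
  | cons a s ih =>
    have h1 := ih fun z hz => hs z (Multiset.mem_cons_of_mem hz)
    have h2 : a ≤ A * Real.exp (a / A - 1) := by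
      have := Real.add_one_le_exp (a / A - 1)
      calc a = A * (a / A - 1 + 1) := by field_simp; ring
        _ ≤ _ := by gcongr
    have h3 : 0 ≤ s.prod := Multiset.prod_nonneg fun z hz => hs z (Multiset.mem_cons_of_mem hz)
    rw [Multiset.prod_cons, Multiset.sum_cons, Multiset.card_cons]
    calc a * s.prod ≤ (A * Real.exp (a / A - 1)) * (A ^ s.card * Real.exp (s.sum / A - s.card)) :=
          mul_le_mul h2 h1 h3 (by positivity)
      _ = A ^ (s.card + 1) * (Real.exp (a / A - 1) * Real.exp (s.sum / A - s.card)) := by ring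
      _ = _ := by
          rw [← Real.exp_add]; congr 2; push_cast; ring

lemma multiset_prod_le_pow {A : ℝ} (hA : 0 < A) (s : Multiset ℝ) (hs : ∀ z ∈ s, 0 ≤ z)
    (h : s.sum = s.card * A) : s.prod ≤ A ^ s.card := by
  have := multiset_prod_le_exp hA s hs
  rwa [h, mul_div_assoc, div_self hA.ne', mul_one, sub_self, Real.exp_zero, mul_one] at this

lemma sum_map_one_add_mul (t : ℝ) (s : Multiset ℝ) :
    (s.map fun y => 1 + t * y).sum = s.card + t * s.sum := by
  simpa [Multiset.sum_map_add] using Multiset.sum_map_mul_left (f := fun y : ℝ => y) (a := t) (s := s)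

/-- The univariate capacity inequality for a polynomial with real nonpositive roots. -/
lemma capFactor_mul_le {s : Multiset ℝ} (hs : ∀ y ∈ s, 0 ≤ y) (hk : 1 ≤ s.card) {a C : ℝ}
    (ha : 0 < a) (hC : 0 < C) (h : ∀ t : ℝ, 0 < t → C * t ≤ a * (s.map fun y => 1 + t * y).prod) :
    capFactor s.card * C ≤ a * s.sum := by
  have hY : 0 ≤ s.sum := Multiset.sum_nonneg hs
  have hbound : ∀ t : ℝ, 0 < t → C * t ≤ a * (1 + t * s.sum / s.card) ^ s.card := by
    intro t ht
    refine (h t ht).trans (mul_le_mul_of_nonneg_left ?_ ha.le)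
    have hk' : (0 : ℝ) < s.card := by exact_mod_cast hk
    have := multiset_prod_le_pow (A := 1 + t * s.sum / s.card) (by positivity)
      (s.map fun y => 1 + t * y) (by
        intro z hz
        obtain ⟨y, hy, rfl⟩ := Multiset.mem_map.1 hz
        have := hs y hy
        positivity) (by rw [sum_map_one_add_mul, Multiset.card_map]; field_simp)
    rwa [Multiset.card_map] at this
  obtain ⟨k, hk2⟩ : ∃ k, s.card = k + 1 := ⟨s.card - 1, by omega⟩
  rw [hk2] at hbound ⊢
  unfold capFactor
  rcases Nat.eq_zero_or_pos k with rfl | hkpos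
  -- Degree one: the infimum of `(1 + t Y) / t` is only approached as `t → ∞`, so a large `t`
  -- refutes the converse.
  · simp only [zero_add, Nat.sub_self, pow_zero, one_mul]
    by_contra! hlt
    have h1 := hbound (a / (C - a * s.sum) + 1) (by
      have : 0 < C - a * s.sum := by linarith
      positivity)
    have h2 : (C - a * s.sum) * (a / (C - a * s.sum)) = a :=
      mul_div_cancel₀ _ (by linarith)
    simp at h1
    nlinarith
  · have hkR : (0 : ℝ) < k := by exact_mod_cast hkpos
    rcases hY.eq_or_lt with hY0 | hYpos
    · exfalso
      have := hbound (a / C + 1) (by positivity)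
      rw [← hY0] at this
      simp only [mul_zero, zero_div, add_zero, one_pow, mul_one] at this
      rw [mul_add, mul_div_cancel₀ _ hC.ne'] at this
      linarith
    -- This `t` minimizes `(1 + t Y / (k + 1)) ^ (k + 1) / t`, where `Y = s.sum`.
    · have h1 := hbound (((k : ℝ) + 1) / (k * s.sum)) (by positivity)
      have e1 : 1 + ((k : ℝ) + 1) / (k * s.sum) * s.sum / ((k + 1 : ℕ) : ℝ) = ((k : ℝ) + 1) / k := by
        push_cast; field_simp
      rw [e1] at h1
      have e2 : (((k + 1 : ℕ) : ℝ) - 1) / ((k + 1 : ℕ) : ℝ) = (k : ℝ) / (k + 1) := by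
        push_cast; ring
      rw [e2, Nat.add_sub_cancel]
      calc ((k : ℝ) / (k + 1)) ^ k * C
          = ((k : ℝ) / (k + 1)) ^ k * (C * (((k : ℝ) + 1) / (k * s.sum))) *
              (k * s.sum / ((k : ℝ) + 1)) := by field_simp
        _ ≤ ((k : ℝ) / (k + 1)) ^ k * (a * (((k : ℝ) + 1) / k) ^ (k + 1)) *
              (k * s.sum / ((k : ℝ) + 1)) := by gcongr
        _ = a * s.sum := by
            rw [pow_succ, div_pow, div_pow]; field_simp

/-- The telescoping step that turns the product of all `capFactor`s into `n!/n^n`. -/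
lemma capFactor_mul_factorial (n : ℕ) :
    capFactor (n + 2) * (((n + 1).factorial : ℝ) / ((n : ℝ) + 1) ^ (n + 1)) =
      ((n + 2).factorial : ℝ) / ((n : ℝ) + 2) ^ (n + 2) := by
  unfold capFactor
  have e : (((n + 2 : ℕ) : ℝ) - 1) = (n : ℝ) + 1 := by push_cast; ring
  rw [e, show n + 2 - 1 = n + 1 from rfl, div_pow, Nat.factorial_succ (n + 1)]
  push_cast
  have : (n : ℝ) + 1 ≠ 0 := by positivity
  have : (n : ℝ) + 2 ≠ 0 := by positivity
  rw [pow_succ ((n : ℝ) + 2) (n + 1)]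
  field_simp
  ring

end PermMin

/-! ### Stable polynomials and Gurvits' inequality. -/

namespace PermMin

open MvPolynomial

/-- `P` does not vanish at points whose coordinates have nonnegative real parts, not all zero. -/
def StrictlyStable {n : ℕ} (P : MvPolynomial (Fin n) ℂ) : Prop :=
  ∀ z : Fin n → ℂ, (∀ i, 0 ≤ (z i).re) → (∃ i, 0 < (z i).re) → eval z P ≠ 0

/-- The coefficient of the first power of the first variable. -/
noncomputable def linearCoeff {R : Type*} [CommSemiring R] {n : ℕ}
    (p : MvPolynomial (Fin (n + 1)) R) : MvPolynomial (Fin n) R :=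
  (finSuccEquiv R n p).coeff 1

/-- The restriction of `p` to a line in the direction of the first variable. -/
noncomputable def lineRestrict {R : Type*} [CommSemiring R] {n : ℕ}
    (p : MvPolynomial (Fin (n + 1)) R) (x : Fin n → R) : Polynomial R :=
  (finSuccEquiv R n p).map (eval x)

lemma eval_lineRestrict {R : Type*} [CommSemiring R] {n : ℕ}
    (p : MvPolynomial (Fin (n + 1)) R) (x : Fin n → R) (t : R) :
    (lineRestrict p x).eval t = eval (Fin.cons t x : Fin (n + 1) → R) p :=
  (eval_eq_eval_mv_eval' x t p).symm

lemma lineRestrict_coeff_one {R : Type*} [CommSemiring R] {n : ℕ}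
    (p : MvPolynomial (Fin (n + 1)) R) (x : Fin n → R) :
    (lineRestrict p x).coeff 1 = eval x (linearCoeff p) := by
  simp [lineRestrict, linearCoeff]

lemma map_finSuccEquiv_coeff {R S : Type*} [CommSemiring R] [CommSemiring S] (f : R →+* S) {n : ℕ}
    (p : MvPolynomial (Fin (n + 1)) R) (i : ℕ) :
    map f ((finSuccEquiv R n p).coeff i) = (finSuccEquiv S n (map f p)).coeff i := by
  ext m
  simp [coeff_map, finSuccEquiv_coeff_coeff]

lemma lineRestrict_map {R S : Type*} [CommSemiring R] [CommSemiring S] (f : R →+* S) {n : ℕ}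
    (p : MvPolynomial (Fin (n + 1)) R) (x : Fin n → R) :
    (lineRestrict p x).map f = lineRestrict (map f p) (f ∘ x) := by
  ext i
  simp only [lineRestrict, Polynomial.coeff_map, ← map_finSuccEquiv_coeff, eval_map]
  exact eval₂_comp ..

lemma eval_smul_of_isHomogeneous {R : Type*} [CommSemiring R] {n N : ℕ}
    {p : MvPolynomial (Fin n) R} (hp : p.IsHomogeneous N) (a : R) (z : Fin n → R) :
    eval (a • z) p = a ^ N * eval z p := by
  rw [eval_eq', eval_eq', Finset.mul_sum]
  refine Finset.sum_congr rfl fun d hd => ?_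
  have hN : ∑ i, d i = N := by
    have := hp (mem_support_iff.1 hd)
    rw [Finsupp.weight_apply, Finsupp.sum_fintype _ _ (by simp)] at this
    simpa using this
  simp only [Pi.smul_apply, smul_eq_mul, mul_pow, Finset.prod_mul_distrib,
    Finset.prod_pow_eq_pow_sum, hN]
  ring

lemma finSuccEquiv_natDegree_le {R : Type*} [CommSemiring R] {n N : ℕ}
    {p : MvPolynomial (Fin (n + 1)) R} (hp : p.IsHomogeneous N) :
    (finSuccEquiv R n p).natDegree ≤ N := by
  rw [natDegree_finSuccEquiv]
  exact (degreeOf_le_totalDegree _ _).trans hp.totalDegree_le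

/-- By homogeneity the coefficient of `t^N` is a constant and all lower ones vanish at the origin.
-/
lemma eval_coeff_top {R : Type*} [CommSemiring R] {n N : ℕ}
    {p : MvPolynomial (Fin (n + 1)) R} (hp : p.IsHomogeneous N) (x : Fin n → R) :
    eval x ((finSuccEquiv R n p).coeff N) = eval (Fin.cons 1 0 : Fin (n + 1) → R) p := by
  have h0 := hp.finSuccEquiv_coeff_isHomogeneous N 0 (by simp)
  have h1 : eval x ((finSuccEquiv R n p).coeff N) = eval 0 ((finSuccEquiv R n p).coeff N) := by
    have := eval_smul_of_isHomogeneous h0 0 x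
    rw [zero_smul, pow_zero, one_mul] at this
    exact this.symm
  rw [h1, eval_eq_eval_mv_eval', Polynomial.eval_eq_sum_range' (n := N + 1)
    (Nat.lt_succ_of_le (Polynomial.natDegree_map_le.trans (finSuccEquiv_natDegree_le hp))),
    Finset.sum_range_succ, Finset.sum_eq_zero]
  · simp
  · intro i hi
    have hi' := Finset.mem_range.1 hi
    have h2 := hp.finSuccEquiv_coeff_isHomogeneous i (N - i) (by omega)
    have := eval_smul_of_isHomogeneous h2 0 0
    rw [zero_smul, zero_pow (by omega), zero_mul] at this
    simpa using this

lemma multiset_sum_re_pos (s : Multiset ℂ) (hs : s ≠ 0) (h : ∀ x ∈ s, 0 < x.re) : 0 < s.sum.re := by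
  induction s using Multiset.induction with
  | empty => exact absurd rfl hs
  | cons a s ih =>
    rw [Multiset.sum_cons, Complex.add_re]
    have ha := h a (Multiset.mem_cons_self a s)
    rcases eq_or_ne s 0 with rfl | hs'
    · simpa using ha
    · exact add_pos ha (ih hs' fun x hx => h x (Multiset.mem_cons_of_mem hx))

/-- Along the first variable all roots `ρ` have negative real part, so the logarithmic derivative at
0, `∑ 1 / (0 - ρ)`, has positive real part and cannot vanish. -/
lemma StrictlyStable.linearCoeff {n N : ℕ} {P : MvPolynomial (Fin (n + 1)) ℂ}
    (hP : StrictlyStable P) (hom : P.IsHomogeneous N) (hN : 1 ≤ N) :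
    StrictlyStable (linearCoeff P) := by
  intro z hz hzp
  have hroot : ∀ t : ℂ, 0 ≤ t.re → (lineRestrict P z).eval t ≠ 0 := by
    intro t ht
    rw [eval_lineRestrict]
    obtain ⟨i, hi⟩ := hzp
    exact hP _ (Fin.cases ht hz) ⟨i.succ, by simpa using hi⟩
  -- Strict stability covers the boundary point `(1, 0, …, 0)`, so the degree does not drop.
  have htop : (lineRestrict P z).coeff N ≠ 0 := by
    rw [lineRestrict, Polynomial.coeff_map, eval_coeff_top hom]
    exact hP _ (Fin.cases (by simp) (by simp)) ⟨0, by simp⟩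
  have hdeg : (lineRestrict P z).natDegree ≠ 0 := by
    have := Polynomial.le_natDegree_of_ne_zero htop
    omega
  have hsp := IsAlgClosed.splits (lineRestrict P z)
  have h0 := hroot 0 (by simp)
  have hder := hsp.eval_derivative_div_eval_of_ne_zero h0
  rw [← Polynomial.coeff_zero_eq_eval_zero, Polynomial.coeff_derivative] at hder
  simp only [zero_add, Nat.cast_zero, mul_one, lineRestrict_coeff_one] at hder
  intro hq
  rw [hq, zero_div] at hder
  have := multiset_sum_re_pos ((lineRestrict P z).roots.map fun ρ => 1 / (0 - ρ))
    (by
      rw [Ne, Multiset.map_eq_zero]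
      exact hsp.roots_ne_zero hdeg) (by
      intro x hx
      obtain ⟨ρ, hρ, rfl⟩ := Multiset.mem_map.1 hx
      have h1 : (lineRestrict P z).eval ρ = 0 := (Polynomial.mem_roots'.1 hρ).2
      have h2 : ρ.re < 0 := by
        by_contra! h
        exact hroot ρ h h1
      rw [zero_sub, one_div, Complex.inv_re, Complex.neg_re]
      have h3 : (-ρ) ≠ 0 := by
        rintro h
        rw [neg_eq_zero] at h
        simp [h] at h2
      exact div_pos (by linarith) (Complex.normSq_pos.2 h3))
  rw [← hder] at this
  simp at this

/-- Along the first variable, a strictly stable homogeneous polynomial factors over the reals. -/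
lemma exists_multiset_of_strictlyStable {n N : ℕ} {p : MvPolynomial (Fin (n + 2)) ℝ}
    (hom : p.IsHomogeneous N) (hst : StrictlyStable (map (algebraMap ℝ ℂ) p))
    {x : Fin (n + 1) → ℝ} (hx : ∀ i, 0 < x i) (hpos : 0 < eval (Fin.cons 1 x : Fin (n + 2) → ℝ) p) :
    ∃ (s : Multiset ℝ) (a : ℝ), s.card = N ∧ (∀ y ∈ s, 0 ≤ y) ∧ 0 < a ∧
      (∀ t, eval (Fin.cons t x : Fin (n + 2) → ℝ) p = a * (s.map fun y => 1 + t * y).prod) ∧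
      eval x (linearCoeff p) = a * s.sum := by
  set R := lineRestrict p x with hR
  have hmap : ∀ t : ℂ, (R.map (algebraMap ℝ ℂ)).eval t =
      eval (Fin.cons t (fun i => (x i : ℂ)) : Fin (n + 2) → ℂ) (map (algebraMap ℝ ℂ) p) := by
    intro t
    rw [hR, lineRestrict_map, eval_lineRestrict]
    rfl
  have hmapR : ∀ t : ℝ, R.eval t = 0 → (R.map (algebraMap ℝ ℂ)).eval (t : ℂ) = 0 := by
    intro t ht
    have := Polynomial.eval_map_algebraMap (R := ℝ) (B := ℂ) R (t : ℂ)
    rw [this, show (t : ℂ) = algebraMap ℝ ℂ t from rfl, Polynomial.aeval_algebraMap_apply]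
    simp [ht]
  have hnr : ∀ ρ : ℂ, (R.map (algebraMap ℝ ℂ)).eval ρ = 0 → ρ.im = 0 ∧ ρ.re < 0 := by
    intro ρ hρ
    rw [hmap] at hρ
    constructor
    -- Multiplying by `-I * ρ.im` sends `ρ` to real part `ρ.im ^ 2 > 0` and the real `x i` to the
    -- imaginary axis; homogeneity keeps the value zero, contradicting strict stability.
    · by_contra hv
      have h1 := eval_smul_of_isHomogeneous (hom.map (algebraMap ℝ ℂ)) (-Complex.I * ρ.im)
        (Fin.cons ρ (fun i => (x i : ℂ)) : Fin (n + 2) → ℂ)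
      rw [hρ, mul_zero] at h1
      refine hst _ ?_ ⟨0, ?_⟩ h1
      · refine Fin.cases ?_ fun i => ?_
        · simp; nlinarith [mul_self_nonneg ρ.im]
        · simp
      · simp; exact hv
    · by_contra! hu
      refine hst _ ?_ ⟨(0 : Fin (n + 1)).succ, ?_⟩ hρ
      · refine Fin.cases (by simpa using hu) fun i => ?_
        simpa using (hx i).le
      · simpa using hx 0
  have hsp : R.Splits := by
    refine Polynomial.Splits.of_splits_map (algebraMap ℝ ℂ) (IsAlgClosed.splits _) fun ρ hρ => ?_
    have := hnr ρ (Polynomial.mem_roots'.1 hρ).2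
    exact ⟨ρ.re, by apply Complex.ext <;> simp [this.1]⟩
  have hneg : ∀ ρ ∈ R.roots, ρ < 0 := by
    intro ρ hρ
    simpa using (hnr ρ (hmapR ρ (Polynomial.mem_roots'.1 hρ).2)).2
  have htop : R.coeff N ≠ 0 := by
    rw [hR, lineRestrict, Polynomial.coeff_map, eval_coeff_top hom]
    intro h
    refine hst (Fin.cons 1 0) (Fin.cases (by simp) (by simp)) ⟨0, by simp⟩ ?_
    have : (Fin.cons 1 0 : Fin (n + 2) → ℂ) = algebraMap ℝ ℂ ∘ (Fin.cons 1 0 : Fin (n + 2) → ℝ) := by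
      funext i
      refine Fin.cases (by simp) (fun i => by simp) i
    rw [this, eval_map, ← eval₂_comp, h, map_zero]
  have hdeg : R.natDegree = N :=
    le_antisymm (Polynomial.natDegree_map_le.trans (finSuccEquiv_natDegree_le hom))
      (Polynomial.le_natDegree_of_ne_zero htop)
  set s := R.roots.map fun ρ => 1 / (0 - ρ) with hs
  have hy : ∀ y ∈ s, 0 < y := by
    intro y hy
    obtain ⟨ρ, hρ, rfl⟩ := Multiset.mem_map.1 hy
    have := hneg ρ hρ
    exact one_div_pos.2 (by linarith)
  have hev : ∀ t, R.eval t = R.eval 0 * (s.map fun y => 1 + t * y).prod := by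
    intro t
    rw [hsp.eval_eq_prod_roots, hsp.eval_eq_prod_roots, mul_assoc, hs, Multiset.map_map,
      ← Multiset.prod_map_mul]
    congr 1
    refine congr_arg Multiset.prod (Multiset.map_congr rfl fun ρ hρ => ?_)
    have := (hneg ρ hρ).ne
    simp only [Function.comp]
    field_simp
    ring
  have hprod : ∀ t, 0 < t → 0 < (s.map fun y => 1 + t * y).prod := by
    intro t ht
    refine Multiset.prod_induction (fun z : ℝ => 0 < z) _ (fun a b => mul_pos) one_pos fun z hz => ?_
    obtain ⟨y, hy', rfl⟩ := Multiset.mem_map.1 hz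
    have := hy y hy'
    positivity
  have ha : 0 < R.eval 0 := by
    rw [← eval_lineRestrict, ← hR, hev] at hpos
    exact (pos_iff_pos_of_mul_pos hpos).2 (hprod 1 one_pos)
  refine ⟨s, R.eval 0, ?_, fun y h => (hy y h).le, ha, fun t => ?_, ?_⟩
  · rw [hs, Multiset.card_map, ← hsp.natDegree_eq_card_roots, hdeg]
  · rw [← eval_lineRestrict, ← hR, hev]
  · have hder := hsp.eval_derivative_eq_eval_mul_sum ha.ne'
    rw [← Polynomial.coeff_zero_eq_eval_zero, Polynomial.coeff_derivative] at hder
    simp only [zero_add, Nat.cast_zero, mul_one] at hder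
    rw [← lineRestrict_coeff_one, ← hR, hder]

/-- The all-ones exponent. -/
noncomputable def onesExp (n : ℕ) : Fin n →₀ ℕ := Finsupp.equivFunOnFinite.symm 1

lemma cons_onesExp (n : ℕ) : Finsupp.cons 1 (onesExp n) = onesExp (n + 1) := by
  ext i
  refine Fin.cases ?_ (fun i => ?_) i
  · simp [onesExp]
  · simp [onesExp]

lemma coeff_onesExp_linearCoeff {R : Type*} [CommSemiring R] {n : ℕ}
    (p : MvPolynomial (Fin (n + 1)) R) :
    coeff (onesExp n) (linearCoeff p) = coeff (onesExp (n + 1)) p := by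
  rw [linearCoeff, finSuccEquiv_coeff_coeff, cons_onesExp]

/-- Gurvits' capacity inequality. -/
theorem capacity_le_coeff_onesExp (n : ℕ) (p : MvPolynomial (Fin (n + 1)) ℝ)
    (hom : p.IsHomogeneous (n + 1)) (hst : StrictlyStable (map (algebraMap ℝ ℂ) p))
    {C : ℝ} (hC : 0 < C) (h : ∀ x : Fin (n + 1) → ℝ, (∀ i, 0 < x i) → C * ∏ i, x i ≤ eval x p) :
    (((n + 1).factorial : ℝ) / ((n : ℝ) + 1) ^ (n + 1)) * C ≤ coeff (onesExp (n + 1)) p := by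
  induction n generalizing C with
  | zero =>
    have h1 := h (Fin.cons 1 0) (by intro i; fin_cases i; simp)
    rw [← eval_coeff_top hom 0, eval_zero, constantCoeff_eq] at h1
    rw [← coeff_onesExp_linearCoeff, linearCoeff, show onesExp 0 = 0 from Subsingleton.elim _ _]
    simpa using h1
  | succ n ih =>
    have hlin : ∀ x : Fin (n + 1) → ℝ, (∀ i, 0 < x i) →
        (capFactor (n + 2) * C) * ∏ i, x i ≤ eval x (linearCoeff p) := by
      intro x hx
      have hxp : 0 < ∏ i, x i := Finset.prod_pos fun i _ => hx i
      have hcons : ∀ t : ℝ, 0 < t → C * (∏ i, x i) * t ≤ eval (Fin.cons t x : Fin (n + 2) → ℝ) p := by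
        intro t ht
        have := h (Fin.cons t x) (Fin.cases (by simpa using ht) (by simpa using hx))
        rw [Fin.prod_univ_succ] at this
        simp only [Fin.cons_zero, Fin.cons_succ] at this
        linarith
      obtain ⟨s, a, hcard, hy, ha, hev, hco⟩ := exists_multiset_of_strictlyStable hom hst hx
        (lt_of_lt_of_le (by positivity) (hcons 1 one_pos))
      have := capFactor_mul_le hy (by omega) ha (C := C * ∏ i, x i) (by positivity) fun t ht => by
        rw [← hev]; exact hcons t ht
      rw [hcard, ← hco] at this
      linarith
    have hpos : 0 < capFactor (n + 2) := by
      unfold capFactor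
      push_cast
      have : (0 : ℝ) < (n : ℝ) + 2 - 1 := by linarith [(n.cast_nonneg : (0 : ℝ) ≤ n)]
      positivity
    have := ih (linearCoeff p) (hom.finSuccEquiv_coeff_isHomogeneous 1 (n + 1) (by ring)) (by
      rw [linearCoeff, map_finSuccEquiv_coeff]
      exact hst.linearCoeff (hom.map _) (by omega)) (mul_pos hpos hC) hlin
    rw [coeff_onesExp_linearCoeff] at this
    refine le_trans (le_of_eq ?_) this
    rw [← mul_assoc, mul_comm _ (capFactor _), capFactor_mul_factorial]
    push_cast
    ring

end PermMin

/-! ### Products of linear forms, and matrices with a zero entry. -/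

namespace PermMin

open MvPolynomial

/-- The product of the linear forms given by the rows of a matrix. -/
noncomputable def rowProduct {R : Type*} [CommSemiring R] {n : ℕ} (M : Matrix (Fin n) (Fin n) R) :
    MvPolynomial (Fin n) R :=
  ∏ i, ∑ j, C (M i j) * X j

lemma eval_rowProduct {R : Type*} [CommSemiring R] {n : ℕ} (M : Matrix (Fin n) (Fin n) R)
    (x : Fin n → R) : eval x (rowProduct M) = ∏ i, ∑ j, M i j * x j := by
  simp [rowProduct, map_prod]

lemma map_rowProduct {R S : Type*} [CommSemiring R] [CommSemiring S] (f : R →+* S) {n : ℕ}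
    (M : Matrix (Fin n) (Fin n) R) : map f (rowProduct M) = rowProduct (M.map f) := by
  simp [rowProduct, map_prod]

lemma rowProduct_isHomogeneous {R : Type*} [CommSemiring R] {n : ℕ}
    (M : Matrix (Fin n) (Fin n) R) : (rowProduct M).IsHomogeneous n := by
  have := IsHomogeneous.prod (Finset.univ : Finset (Fin n)) (fun i => ∑ j, C (M i j) * X j)
    (fun _ => 1) fun i _ => IsHomogeneous.sum _ _ _ fun j _ => isHomogeneous_C_mul_X (M i j) j
  simpa [rowProduct] using this

lemma sum_single_eq_onesExp_iff {n : ℕ} (f : Fin n → Fin n) :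
    ∑ i, Finsupp.single (f i) 1 = onesExp n ↔ Function.Bijective f := by
  have key : ∀ j, (∑ i, Finsupp.single (f i) 1 : Fin n →₀ ℕ) j =
      (Finset.univ.filter fun i => f i = j).card := by
    intro j
    simp [Finsupp.finsetSum_apply, Finsupp.single_apply]
  constructor
  · intro h
    refine Finite.surjective_iff_bijective.1 fun j => ?_
    have hj := key j
    rw [h] at hj
    simp only [onesExp, Finsupp.equivFunOnFinite_symm_apply_apply, Pi.one_apply] at hj
    obtain ⟨i, hi⟩ := Finset.card_pos.1 (hj ▸ one_pos)
    exact ⟨i, (Finset.mem_filter.1 hi).2⟩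
  · intro h
    ext j
    rw [key]
    obtain ⟨i, hi⟩ := h.2 j
    have : (Finset.univ.filter fun i => f i = j) = {i} := by
      ext k
      simp only [Finset.mem_filter, Finset.mem_univ, true_and, Finset.mem_singleton]
      exact ⟨fun hk => h.1 (hk.trans hi.symm), fun hk => hk ▸ hi⟩
    simp [this, onesExp]

lemma coeff_onesExp_rowProduct {R : Type*} [CommSemiring R] {n : ℕ}
    (M : Matrix (Fin n) (Fin n) R) : coeff (onesExp n) (rowProduct M) = M.permanent := by
  classical
  have hterm : ∀ f : Fin n → Fin n, coeff (onesExp n) (∏ i, (C (M i (f i)) * X (f i))) =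
      if Function.Bijective f then ∏ i, M i (f i) else 0 := by
    intro f
    have : ∏ i, (C (M i (f i)) * X (f i)) =
        monomial (∑ i, Finsupp.single (f i) 1) (∏ i, M i (f i)) := by
      rw [monomial_sum_index, Finset.prod_mul_distrib, map_prod]
      rfl
    rw [this, coeff_monomial]
    simp only [sum_single_eq_onesExp_iff]
  rw [rowProduct, Finset.prod_univ_sum, coeff_sum, Fintype.piFinset_univ,
    Finset.sum_congr rfl fun f _ => hterm f, ← Finset.sum_filter, ← Matrix.permanent_transpose,
    Matrix.permanent]
  symm
  refine Finset.sum_bij (fun σ _ => (σ : Fin n → Fin n)) ?_ ?_ ?_ ?_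
  · intro σ _
    exact Finset.mem_filter.2 ⟨Finset.mem_univ _, σ.bijective⟩
  · intro σ _ τ _ h
    exact DFunLike.coe_injective h
  · intro f hf
    exact ⟨Equiv.ofBijective f (by simpa using hf), Finset.mem_univ _, rfl⟩
  · intro σ _
    rfl

lemma lineRestrict_rowProduct {R : Type*} [CommSemiring R] {n : ℕ}
    (M : Matrix (Fin (n + 1)) (Fin (n + 1)) R) (x : Fin n → R) :
    lineRestrict (rowProduct M) x =
      ∏ i, (Polynomial.C (∑ j : Fin n, M i j.succ * x j) + Polynomial.C (M i 0) * Polynomial.X) := by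
  have hC : ∀ a : R, finSuccEquiv R n (C a) = Polynomial.C (C a) := fun a => by
    simp [finSuccEquiv_apply]
  rw [lineRestrict, rowProduct, map_prod, Polynomial.map_prod]
  refine Finset.prod_congr rfl fun i _ => ?_
  rw [map_sum, Polynomial.map_sum, Fin.sum_univ_succ]
  simp [finSuccEquiv_X_zero, finSuccEquiv_X_succ, hC, Polynomial.map_mul, map_sum, add_comm]

lemma coeff_prod_linear {F ι : Type*} [Field F] (s : Finset ι) (a b : ι → F)
    (ha : ∀ i ∈ s, a i ≠ 0) :
    (∏ i ∈ s, (Polynomial.C (a i) + Polynomial.C (b i) * Polynomial.X)).coeff 1 =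
      (∏ i ∈ s, a i) * ∑ i ∈ s, b i / a i := by
  classical
  induction s using Finset.induction with
  | empty => simp [Polynomial.coeff_one]
  | insert i s hi ih =>
    have h0 : (∏ i ∈ s, (Polynomial.C (a i) + Polynomial.C (b i) * Polynomial.X)).coeff 0 =
        ∏ i ∈ s, a i := by
      simp [Polynomial.coeff_zero_prod]
    have hai := ha i (Finset.mem_insert_self i s)
    rw [Finset.prod_insert hi, Finset.prod_insert hi, Finset.sum_insert hi,
      Polynomial.mul_coeff_one, ih fun k hk => ha k (Finset.mem_insert_of_mem hk), h0]
    simp [Polynomial.coeff_C]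
    field_simp
    ring

lemma eval_linearCoeff_rowProduct {F : Type*} [Field F] {n : ℕ}
    (M : Matrix (Fin (n + 1)) (Fin (n + 1)) F) (x : Fin n → F)
    (hx : ∀ i, ∑ j : Fin n, M i j.succ * x j ≠ 0) :
    eval x (linearCoeff (rowProduct M)) = (∏ i, ∑ j : Fin n, M i j.succ * x j) *
      ∑ i, M i 0 / ∑ j : Fin n, M i j.succ * x j := by
  rw [← lineRestrict_coeff_one, lineRestrict_rowProduct, coeff_prod_linear _ _ _ fun i _ => hx i]

/-- The linear coefficient is `∏ l_i * ∑ M i 0 / l_i`; each `l_i`, hence each `1 / l_i`, has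
positive real part. -/
lemma strictlyStable_linearCoeff_rowProduct {n : ℕ} {M : Matrix (Fin (n + 1)) (Fin (n + 1)) ℝ}
    (hM : ∀ i j, 0 ≤ M i j) (hpos : ∀ i (j : Fin n), 0 < M i j.succ) (hcol : ∃ i, 0 < M i 0) :
    StrictlyStable (map (algebraMap ℝ ℂ) (linearCoeff (rowProduct M))) := by
  intro z hz hzp
  obtain ⟨k, hk⟩ := hzp
  rw [linearCoeff, map_finSuccEquiv_coeff, map_rowProduct]
  have hre : ∀ i, 0 < (∑ j : Fin n, (M.map (algebraMap ℝ ℂ)) i j.succ * z j).re := by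
    intro i
    rw [Complex.re_sum]
    refine Finset.sum_pos' (fun j _ => ?_) ⟨k, Finset.mem_univ _, ?_⟩
    · simpa using mul_nonneg (hpos i j).le (hz j)
    · simpa using mul_pos (hpos i k) hk
  have hne : ∀ i, ∑ j : Fin n, (M.map (algebraMap ℝ ℂ)) i j.succ * z j ≠ 0 := by
    intro i h
    have := hre i
    rw [h] at this
    simp at this
  change eval z (PermMin.linearCoeff _) ≠ 0
  rw [eval_linearCoeff_rowProduct _ _ hne]
  refine mul_ne_zero (Finset.prod_ne_zero_iff.2 fun i _ => hne i) fun h => ?_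
  have hterm : ∀ i, (M.map (algebraMap ℝ ℂ) i 0 / ∑ j : Fin n, M.map (algebraMap ℝ ℂ) i j.succ * z j).re
      = M i 0 * ((∑ j : Fin n, M.map (algebraMap ℝ ℂ) i j.succ * z j).re /
        Complex.normSq (∑ j : Fin n, M.map (algebraMap ℝ ℂ) i j.succ * z j)) := by
    intro i
    rw [div_eq_mul_inv, Matrix.map_apply]
    simp only [Complex.coe_algebraMap, Complex.re_ofReal_mul, Complex.inv_re]
  have h2 := congr_arg Complex.re h
  rw [Complex.re_sum, Complex.zero_re] at h2
  obtain ⟨i, hi⟩ := hcol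
  have : 0 < ∑ i, (M.map (algebraMap ℝ ℂ) i 0 /
      ∑ j : Fin n, M.map (algebraMap ℝ ℂ) i j.succ * z j).re := by
    refine Finset.sum_pos' (fun i _ => ?_) ⟨i, Finset.mem_univ _, ?_⟩
    · rw [hterm]
      exact mul_nonneg (hM i 0) (div_nonneg (hre i).le (Complex.normSq_nonneg _))
    · rw [hterm]
      exact mul_pos hi (div_pos (hre i) (Complex.normSq_pos.2 (hne i)))
  exact this.ne' h2

/-- `rowProduct M` vanishes at `(1, 0, …, 0)`, so it is not strictly stable. The first extraction
therefore uses the explicit linear factors, and Gurvits' inequality takes over for the linear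
coefficient. -/
lemma le_permanent_of_first_column_zero {n : ℕ} {M : Matrix (Fin (n + 2)) (Fin (n + 2)) ℝ}
    (i₀ : Fin (n + 2)) (h0 : M i₀ 0 = 0) (hM : ∀ i j, (i ≠ i₀ ∨ j ≠ 0) → 0 < M i j) {L : ℝ}
    (hL : 0 < L)
    (h : ∀ x : Fin (n + 2) → ℝ, (∀ i, 0 < x i) → L * ∏ i, x i ≤ ∏ i, ∑ j, M i j * x j) :
    capFactor (n + 1) * (((n + 1).factorial : ℝ) / ((n : ℝ) + 1) ^ (n + 1)) * L ≤ M.permanent := by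
  have hnn : ∀ i j, 0 ≤ M i j := by
    intro i j
    by_cases hij : i ≠ i₀ ∨ j ≠ 0
    · exact (hM i j hij).le
    · push Not at hij
      rw [hij.1, hij.2, h0]
  have hpos : ∀ i (j : Fin (n + 1)), 0 < M i j.succ := fun i j =>
    hM i j.succ (Or.inr (Fin.succ_ne_zero j))
  obtain ⟨i₁, hi₁⟩ := exists_ne i₀
  have hlin : ∀ x : Fin (n + 1) → ℝ, (∀ i, 0 < x i) →
      (capFactor (n + 1) * L) * ∏ i, x i ≤ eval x (linearCoeff (rowProduct M)) := by
    intro x hx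
    have hl : ∀ i, 0 < ∑ j : Fin (n + 1), M i j.succ * x j := fun i =>
      Finset.sum_pos (fun j _ => mul_pos (hpos i j) (hx j)) Finset.univ_nonempty
    rw [eval_linearCoeff_rowProduct _ _ fun i => (hl i).ne']
    set l : Fin (n + 2) → ℝ := fun i => ∑ j : Fin (n + 1), M i j.succ * x j with hldef
    have hxp : 0 < ∏ i, x i := Finset.prod_pos fun i _ => hx i
    -- Row `i₀` contributes nothing, leaving `n + 1` factors instead of `n + 2`: this is the gain.
    have hsum : ∑ i, M i 0 / l i = ((Finset.univ.erase i₀).val.map fun i => M i 0 / l i).sum := by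
      rw [← Finset.add_sum_erase _ _ (Finset.mem_univ i₀), h0, zero_div, zero_add]
      rfl
    have hcard : ((Finset.univ.erase i₀).val.map fun i => M i 0 / l i).card = n + 1 := by
      rw [Multiset.card_map, Finset.card_val, Finset.card_erase_of_mem (Finset.mem_univ _)]
      simp
    have := capFactor_mul_le (s := (Finset.univ.erase i₀).val.map fun i => M i 0 / l i)
      (a := ∏ i, l i) (C := L * ∏ i, x i) (by
        intro y hy
        obtain ⟨i, -, rfl⟩ := Multiset.mem_map.1 hy
        exact div_nonneg (hnn i 0) (hl i).le) (by omega)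
      (Finset.prod_pos fun i _ => hl i) (by positivity) (by
        intro t ht
        have h1 := h (Fin.cons t x) (Fin.cases (by simpa using ht) (by simpa using hx))
        rw [Fin.prod_univ_succ] at h1
        simp only [Fin.cons_zero, Fin.cons_succ] at h1
        refine le_trans (le_of_eq (by ring)) (h1.trans (le_of_eq ?_))
        have e1 : ∀ i, ∑ j, M i j * (Fin.cons t x : Fin (n + 2) → ℝ) j =
            l i * (1 + t * (M i 0 / l i)) := by
          intro i
          have := (hl i).ne'
          rw [Fin.sum_univ_succ]
          simp only [Fin.cons_zero, Fin.cons_succ]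
          change _ + l i = _
          change l i ≠ 0 at this
          field_simp
          ring
        rw [Finset.prod_congr rfl fun i _ => e1 i, Finset.prod_mul_distrib,
          ← Finset.mul_prod_erase _ (fun i => 1 + t * (M i 0 / l i)) (Finset.mem_univ i₀), h0,
          Multiset.map_map]
        simp [Finset.prod])
    rw [hcard, ← hsum] at this
    linarith
  have hcpos : 0 < capFactor (n + 1) := by
    unfold capFactor
    rcases Nat.eq_zero_or_pos n with rfl | hn
    · simp
    · have : (0 : ℝ) < n := by exact_mod_cast hn
      push_cast
      rw [add_sub_cancel_right]
      positivity
  have := capacity_le_coeff_onesExp n (linearCoeff (rowProduct M))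
    ((rowProduct_isHomogeneous M).finSuccEquiv_coeff_isHomogeneous 1 (n + 1) (by ring))
    (strictlyStable_linearCoeff_rowProduct hnn hpos ⟨i₁, hM i₁ 0 (Or.inl hi₁)⟩)
    (mul_pos hcpos hL) hlin
  rw [coeff_onesExp_linearCoeff, coeff_onesExp_rowProduct] at this
  linarith

/-- A nonnegative matrix with a vanishing entry satisfies an improved capacity inequality. -/
theorem le_permanent_of_entry_zero {n : ℕ} {M : Matrix (Fin (n + 2)) (Fin (n + 2)) ℝ}
    {i₀ j₀ : Fin (n + 2)} (h0 : M i₀ j₀ = 0) (hM : ∀ i j, 0 ≤ M i j) {L : ℝ} (hL : 0 < L)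
    (h : ∀ x : Fin (n + 2) → ℝ, (∀ i, 0 < x i) → L * ∏ i, x i ≤ ∏ i, ∑ j, M i j * x j) :
    capFactor (n + 1) * (((n + 1).factorial : ℝ) / ((n : ℝ) + 1) ^ (n + 1)) * L ≤ M.permanent := by
  let σ : Equiv.Perm (Fin (n + 2)) := Equiv.swap 0 j₀
  -- Move the zero to the first column and add `ε` to every other entry. The lower bound on the row
  -- product survives since entries only grow; then `ε → 0`.
  let A : ℝ → Matrix (Fin (n + 2)) (Fin (n + 2)) ℝ := fun ε =>
    Matrix.of fun i j => M i (σ j) + if i ≠ i₀ ∨ j ≠ 0 then ε else 0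
  have hA : ∀ ε > 0, capFactor (n + 1) * (((n + 1).factorial : ℝ) / ((n : ℝ) + 1) ^ (n + 1)) * L ≤
      (A ε).permanent := by
    intro ε hε
    refine le_permanent_of_first_column_zero i₀ ?_ ?_ hL ?_
    · simp [A, σ, h0]
    · intro i j hij
      simp only [A, Matrix.of_apply, if_pos hij]
      have := hM i (σ j)
      positivity
    · intro x hx
      have h1 := h (x ∘ σ) fun i => hx _
      have e : ∏ i, (x ∘ σ) i = ∏ i, x i := Equiv.prod_comp σ x
      rw [e] at h1
      refine h1.trans (Finset.prod_le_prod (fun i _ => Finset.sum_nonneg fun j _ =>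
        mul_nonneg (hM i j) (hx _).le) fun i _ => ?_)
      rw [← Equiv.sum_comp σ]
      refine Finset.sum_le_sum fun j _ => ?_
      have hσ : σ (σ j) = j := Equiv.swap_apply_self _ _ _
      simp only [Function.comp, hσ, A, Matrix.of_apply]
      refine mul_le_mul_of_nonneg_right ?_ (hx j).le
      split_ifs <;> linarith
  have hcont : Continuous fun ε => (A ε).permanent := by
    unfold Matrix.permanent
    refine continuous_finsetSum _ fun τ _ => continuous_finsetProd _ fun i _ => ?_
    simp only [A, Matrix.of_apply]
    split_ifs <;> fun_prop
  have hlim : Filter.Tendsto (fun ε => (A ε).permanent) (nhdsWithin 0 (Set.Ioi 0))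
      (nhds (A 0).permanent) := (hcont.tendsto 0).mono_left nhdsWithin_le_nhds
  have h1 := ge_of_tendsto hlim (by filter_upwards [self_mem_nhdsWithin] with ε hε using hA ε hε)
  have e : A 0 = M.submatrix id σ := by
    ext i j
    simp [A]
  rwa [e, Matrix.permanent_permute_rows] at h1

end PermMin

/-! ### Mixing rows of positive minimizers. -/

namespace PermMin

section Rows

variable {R : Type*} {n : ℕ}

lemma permanent_updateRow [CommSemiring R] (M : Matrix (Fin n) (Fin n) R) (i : Fin n)
    (u : Fin n → R) : (M.updateRow i u).permanent =
      ∑ σ : Equiv.Perm (Fin n), u (σ i) * ∏ k ∈ Finset.univ.erase i, M k (σ k) := by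
  rw [← Matrix.permanent_transpose, Matrix.permanent]
  refine Finset.sum_congr rfl fun σ _ => ?_
  rw [← Finset.mul_prod_erase _ _ (Finset.mem_univ i)]
  congr 1
  · simp
  · refine Finset.prod_congr rfl fun k hk => ?_
    rw [Matrix.transpose_apply, Matrix.updateRow_ne (Finset.ne_of_mem_erase hk)]

lemma permanent_updateRow_add [CommSemiring R] (M : Matrix (Fin n) (Fin n) R) (i : Fin n)
    (u v : Fin n → R) : (M.updateRow i (u + v)).permanent =
      (M.updateRow i u).permanent + (M.updateRow i v).permanent := by
  simp only [permanent_updateRow, Pi.add_apply, add_mul, Finset.sum_add_distrib]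

lemma permanent_updateRow_zero [CommSemiring R] (M : Matrix (Fin n) (Fin n) R) (i : Fin n) :
    (M.updateRow i 0).permanent = 0 := by
  simp [permanent_updateRow]

/-- The permanent as a function of two of the rows. -/
def rowForm [CommSemiring R] (M : Matrix (Fin n) (Fin n) R) (i j : Fin n) (u v : Fin n → R) : R :=
  ((M.updateRow i u).updateRow j v).permanent

lemma rowForm_add_right [CommSemiring R] (M : Matrix (Fin n) (Fin n) R) (i j : Fin n)
    (u v v' : Fin n → R) :
    rowForm M i j u (v + v') = rowForm M i j u v + rowForm M i j u v' :=
  permanent_updateRow_add _ _ _ _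

lemma rowForm_smul_right [CommSemiring R] (M : Matrix (Fin n) (Fin n) R) (i j : Fin n) (a : R)
    (u v : Fin n → R) : rowForm M i j u (a • v) = a * rowForm M i j u v :=
  Matrix.permanent_updateRow_smul _ _ _ _

lemma rowForm_symm [CommSemiring R] (M : Matrix (Fin n) (Fin n) R) {i j : Fin n} (hij : i ≠ j)
    (u v : Fin n → R) : rowForm M i j u v = rowForm M i j v u := by
  have : (M.updateRow i u).updateRow j v =
      ((M.updateRow i v).updateRow j u).submatrix (Equiv.swap i j) id := by
    ext k l
    rw [Matrix.submatrix_apply, id]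
    by_cases hi : k = i
    · subst hi
      rw [Equiv.swap_apply_left, Matrix.updateRow_ne hij, Matrix.updateRow_self,
        Matrix.updateRow_self]
    · by_cases hj : k = j
      · subst hj
        rw [Equiv.swap_apply_right, Matrix.updateRow_self, Matrix.updateRow_ne hij,
          Matrix.updateRow_self]
      · rw [Equiv.swap_apply_of_ne_of_ne hi hj]
        simp only [Matrix.updateRow_ne hj, Matrix.updateRow_ne hi]
  rw [rowForm, this, Matrix.permanent_permute_cols, rowForm]

lemma rowForm_add_left [CommSemiring R] (M : Matrix (Fin n) (Fin n) R) {i j : Fin n} (hij : i ≠ j)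
    (u u' v : Fin n → R) :
    rowForm M i j (u + u') v = rowForm M i j u v + rowForm M i j u' v := by
  rw [rowForm_symm M hij, rowForm_add_right, rowForm_symm M hij, rowForm_symm M hij v]

lemma rowForm_smul_left [CommSemiring R] (M : Matrix (Fin n) (Fin n) R) {i j : Fin n} (hij : i ≠ j)
    (a : R) (u v : Fin n → R) : rowForm M i j (a • u) v = a * rowForm M i j u v := by
  rw [rowForm_symm M hij, rowForm_smul_right, rowForm_symm M hij]

lemma rowForm_self [CommSemiring R] (M : Matrix (Fin n) (Fin n) R) (i j : Fin n) :
    rowForm M i j (M i) (M j) = M.permanent := by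
  rw [rowForm, Matrix.updateRow_eq_self, Matrix.updateRow_eq_self]

/-- Replace rows `i` and `j` by convex combinations of each other. -/
def mix (t : ℝ) (i j : Fin n) (M : Matrix (Fin n) (Fin n) ℝ) : Matrix (Fin n) (Fin n) ℝ :=
  Matrix.of fun k l => (1 - t) * M k l + t * M (Equiv.swap i j k) l

lemma permanent_mix (t : ℝ) {i j : Fin n} (hij : i ≠ j) (M : Matrix (Fin n) (Fin n) ℝ) :
    (mix t i j M).permanent =
      M.permanent + t * (1 - t) * rowForm M i j (M i - M j) (M i - M j) := by
  have e : mix t i j M =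
      (M.updateRow i ((1 - t) • M i + t • M j)).updateRow j ((1 - t) • M j + t • M i) := by
    ext k l
    by_cases hj : k = j
    · subst hj
      simp [mix]
    · rw [Matrix.updateRow_ne hj]
      by_cases hi : k = i
      · subst hi
        simp [mix]
      · rw [Matrix.updateRow_ne hi]
        simp only [mix, Matrix.of_apply, Equiv.swap_apply_of_ne_of_ne hi hj]
        ring
  have e1 : (mix t i j M).permanent =
      rowForm M i j ((1 - t) • M i + t • M j) ((1 - t) • M j + t • M i) := by
    rw [e, rowForm]
  have e2 : M i - M j = M i + (-1 : ℝ) • M j := by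
    rw [neg_one_smul, sub_eq_add_neg]
  rw [e1, e2, ← rowForm_self M i j]
  simp only [rowForm_add_left M hij, rowForm_add_right, rowForm_smul_left M hij,
    rowForm_smul_right, rowForm_symm M hij (M j) (M i)]
  ring

end Rows

/-- `M` minimizes the permanent over `Mat c`. -/
def IsMinimizer {n : ℕ} (c : Fin n → ℝ) (M : Matrix (Fin n) (Fin n) ℝ) : Prop :=
  M ∈ Mat c ∧ IsMinOn Matrix.permanent (Mat c) M

section Minimizers

variable {n : ℕ} {c : Fin n → ℝ}

lemma mix_mem_Mat {M : Matrix (Fin n) (Fin n) ℝ} (hM : M ∈ Mat c) (t : ℝ) (i j : Fin n)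
    (h : ∀ k l, 0 ≤ mix t i j M k l) : mix t i j M ∈ Mat c := by
  refine ⟨h, fun k => ?_, fun l => ?_⟩
  · simp only [mix, Matrix.of_apply, Finset.sum_add_distrib, ← Finset.mul_sum, hM.2.1]
    ring
  · simp only [mix, Matrix.of_apply, Finset.sum_add_distrib, ← Finset.mul_sum, hM.2.2]
    rw [Equiv.sum_comp (Equiv.swap i j) fun k => M k l, hM.2.2]
    ring

lemma mix_nonneg {M : Matrix (Fin n) (Fin n) ℝ} (hM : ∀ i j, 0 ≤ M i j) {t : ℝ}
    (ht : t ∈ Set.Icc (0 : ℝ) 1) (i j k l : Fin n) : 0 ≤ mix t i j M k l :=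
  add_nonneg (mul_nonneg (by linarith [ht.2]) (hM _ _)) (mul_nonneg ht.1 (hM _ _))

/-- Positive entries leave room for slightly negative `t`, and `t * (1 - t)` changes sign at 0. -/
lemma IsMinimizer.rowForm_eq_zero {M : Matrix (Fin n) (Fin n) ℝ} (hM : IsMinimizer c M)
    (hpos : ∀ i j, 0 < M i j) {i j : Fin n} (hij : i ≠ j) :
    rowForm M i j (M i - M j) (M i - M j) = 0 := by
  set D := rowForm M i j (M i - M j) (M i - M j) with hD
  have hev : ∀ᶠ t in nhds (0 : ℝ), ∀ k l, 0 < mix t i j M k l := by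
    refine Filter.eventually_all.2 fun k => Filter.eventually_all.2 fun l => ?_
    have hc : Continuous fun t => mix t i j M k l := by
      simp only [mix, Matrix.of_apply]
      fun_prop
    refine hc.continuousAt.eventually (lt_mem_nhds ?_)
    simpa [mix] using hpos k l
  obtain ⟨ε, hε, h⟩ := Metric.eventually_nhds_iff.1 hev
  have key : ∀ t : ℝ, |t| < ε → 0 ≤ t * (1 - t) * D := by
    intro t ht
    have h1 := hM.2 (mix_mem_Mat hM.1 t i j fun k l => (h (by simpa using ht) k l).le)
    simp only [Set.mem_ofPred_eq, permanent_mix t hij] at h1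
    linarith
  set τ := min ε 1 / 2 with hτ
  have hτ0 : 0 < τ := by positivity
  have hτ1 : τ < 1 := by
    have := min_le_right ε 1
    linarith
  have hτε : τ < ε := by
    have := min_le_left ε 1
    linarith
  have h1 := key τ (by rwa [abs_of_pos hτ0])
  have h2 := key (-τ) (by rwa [abs_neg, abs_of_pos hτ0])
  have h3 : 0 ≤ D := nonneg_of_mul_nonneg_right h1 (mul_pos hτ0 (by linarith))
  have h4 : 0 ≤ -D := by
    refine nonneg_of_mul_nonneg_right (a := τ * (1 + τ)) ?_ (by positivity)
    linarith
  linarith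

lemma IsMinimizer.mix {M : Matrix (Fin n) (Fin n) ℝ} (hM : IsMinimizer c M)
    (hpos : ∀ i j, 0 < M i j) {t : ℝ} (ht : t ∈ Set.Icc (0 : ℝ) 1) {i j : Fin n} (hij : i ≠ j) :
    IsMinimizer c (mix t i j M) := by
  refine ⟨mix_mem_Mat hM.1 t i j fun k l => mix_nonneg hM.1.1 ht i j k l, fun N hN => ?_⟩
  have := hM.2 hN
  simp only [Set.mem_ofPred_eq, permanent_mix t hij, hM.rowForm_eq_zero hpos hij] at this ⊢
  linarith

lemma isCompact_unit_matrices :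
    IsCompact {M : Matrix (Fin n) (Fin n) ℝ | ∀ i j, M i j ∈ Set.Icc (0 : ℝ) 1} := by
  have := isCompact_univ_pi fun _ : Fin n => isCompact_univ_pi fun _ : Fin n =>
    isCompact_Icc (a := (0 : ℝ)) (b := 1)
  have e : (Set.univ.pi fun _ : Fin n => Set.univ.pi fun _ : Fin n => Set.Icc (0 : ℝ) 1) =
      {M : Fin n → Fin n → ℝ | ∀ i j, M i j ∈ Set.Icc (0 : ℝ) 1} :=
    Set.ext fun M => by simp only [Set.mem_univ_pi, Set.mem_ofPred_eq]
  rw [e] at this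
  exact this

lemma mem_Icc_of_row_sum {M : Matrix (Fin n) (Fin n) ℝ} (h0 : ∀ i j, 0 ≤ M i j)
    (h1 : ∀ i, ∑ j, M i j = 1) (i j : Fin n) : M i j ∈ Set.Icc (0 : ℝ) 1 :=
  ⟨h0 i j, h1 i ▸ Finset.single_le_sum (fun l _ => h0 i l) (Finset.mem_univ j)⟩

lemma continuous_entry (i j : Fin n) : Continuous fun M : Matrix (Fin n) (Fin n) ℝ => M i j :=
  continuous_id.matrix_elem i j

lemma continuous_permanent :
    Continuous (Matrix.permanent : Matrix (Fin n) (Fin n) ℝ → ℝ) := by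
  unfold Matrix.permanent
  exact continuous_finsetSum _ fun σ _ => continuous_finsetProd _ fun i _ => continuous_entry _ _

lemma isClosed_Mat (c : Fin n → ℝ) : IsClosed (Mat c) := by
  simp only [Mat, Set.ofPred_and, Set.ofPred_forall]
  refine IsClosed.inter (isClosed_iInter fun i => isClosed_iInter fun j => ?_)
    (IsClosed.inter (isClosed_iInter fun i => ?_) (isClosed_iInter fun j => ?_))
  · exact isClosed_le continuous_const (continuous_entry i j)
  · exact isClosed_eq (continuous_finsetSum _ fun j _ => continuous_entry i j) continuous_const
  · exact isClosed_eq (continuous_finsetSum _ fun i _ => continuous_entry i j) continuous_const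

lemma isCompact_Mat (c : Fin n → ℝ) : IsCompact (Mat c) :=
  isCompact_unit_matrices.of_isClosed_subset (isClosed_Mat c) fun _ hM =>
    mem_Icc_of_row_sum hM.1 hM.2.1

/-- A minimizer can be replaced by one with the same row `i₀` whose other rows coincide. -/
lemma IsMinimizer.exists_equal_rows (hpos : ∀ M, IsMinimizer c M → ∀ i j, 0 < M i j)
    {M : Matrix (Fin n) (Fin n) ℝ} (hM : IsMinimizer c M) (i₀ : Fin n) :
    ∃ N, IsMinimizer c N ∧ N i₀ = M i₀ ∧ ∀ i j, i ≠ i₀ → j ≠ i₀ → N i = N j := by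
  let K : Set (Matrix (Fin n) (Fin n) ℝ) :=
    Mat c ∩ {N | N.permanent ≤ M.permanent} ∩ {N | ∀ l, N i₀ l = M i₀ l}
  have hK : IsCompact K := by
    refine ((isCompact_Mat c).inter_right
      (isClosed_le continuous_permanent continuous_const)).inter_right ?_
    rw [Set.ofPred_forall]
    exact isClosed_iInter fun l => isClosed_eq (continuous_entry i₀ l) continuous_const
  have hKmin : ∀ N ∈ K, IsMinimizer c N := by
    refine fun N hN => ⟨hN.1.1, fun A hA => ?_⟩
    have h1 : N.permanent ≤ M.permanent := hN.1.2
    have h2 : M.permanent ≤ A.permanent := hM.2 hA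
    exact h1.trans h2
  -- Minimizing the sum of squares stands in for the limit of repeated averaging: averaging two
  -- distinct rows would strictly decrease it.
  obtain ⟨N, hNK, hN⟩ := hK.exists_isMinOn (f := fun N : Matrix (Fin n) (Fin n) ℝ =>
    ∑ k, ∑ l, N k l ^ 2) ⟨M, ⟨hM.1, le_refl M.permanent⟩, fun _ => rfl⟩
    (Continuous.continuousOn (continuous_finsetSum _ fun k _ => continuous_finsetSum _ fun l _ =>
      (continuous_entry k l).pow 2))
  refine ⟨N, hKmin N hNK, funext hNK.2, fun i j hi hj => ?_⟩
  by_cases hij : i = j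
  · rw [hij]
  have hmix := (hKmin N hNK).mix (hpos N (hKmin N hNK)) (t := 1 / 2)
    ⟨by norm_num, by norm_num⟩ hij
  have hmixK : PermMin.mix (1 / 2) i j N ∈ K := by
    refine ⟨⟨hmix.1, hmix.2 hM.1⟩, fun l => ?_⟩
    have := hNK.2 l
    simp only [PermMin.mix, Matrix.of_apply, Equiv.swap_apply_of_ne_of_ne hi.symm hj.symm, this]
    ring
  have hle : ∑ k, ∑ l, N k l ^ 2 ≤ ∑ k, ∑ l, (PermMin.mix (1 / 2) i j N) k l ^ 2 := hN hmixK
  have e : ∑ k, ∑ l, (PermMin.mix (1 / 2) i j N) k l ^ 2 = (1 / 2) * ∑ k, ∑ l, N k l ^ 2 +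
      (1 / 2) * ∑ k, ∑ l, N (Equiv.swap i j k) l ^ 2 -
      (1 / 4) * ∑ k, ∑ l, (N k l - N (Equiv.swap i j k) l) ^ 2 := by
    simp only [Finset.mul_sum, ← Finset.sum_add_distrib, ← Finset.sum_sub_distrib]
    refine Finset.sum_congr rfl fun k _ => Finset.sum_congr rfl fun l _ => ?_
    simp only [PermMin.mix, Matrix.of_apply]
    ring
  rw [e, Equiv.sum_comp (Equiv.swap i j) fun k => ∑ l, N k l ^ 2] at hle
  have hz : ∑ k, ∑ l, (N k l - N (Equiv.swap i j k) l) ^ 2 = 0 :=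
    le_antisymm (by linarith) (Finset.sum_nonneg fun k _ => Finset.sum_nonneg fun l _ => sq_nonneg _)
  funext l
  have h1 := (Finset.sum_eq_zero_iff_of_nonneg fun k _ => Finset.sum_nonneg fun l _ =>
    sq_nonneg _).1 hz i (Finset.mem_univ i)
  have h2 := (Finset.sum_eq_zero_iff_of_nonneg fun l _ => sq_nonneg _).1 h1 l (Finset.mem_univ l)
  rw [Equiv.swap_apply_left] at h2
  exact sub_eq_zero.1 (pow_eq_zero_iff two_ne_zero |>.1 h2)

/-- The matrix whose rows `v + x i • w` lie on a line. -/
def lineMat {R : Type*} [CommSemiring R] (v w x : Fin n → R) : Matrix (Fin n) (Fin n) R :=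
  Matrix.of fun i j => v j + x i * w j

lemma mix_lineMat (v w x : Fin n → ℝ) (t : ℝ) (i j : Fin n) :
    mix t i j (lineMat v w x) =
      lineMat v w fun k => (1 - t) * x k + t * x (Equiv.swap i j k) := by
  ext k l
  simp only [mix, lineMat, Matrix.of_apply]
  ring

/-- Successive mixes of row `i₀` with the rows of `A` hand each of them a share `u` of the
displacement `w`. -/
lemma isMinimizer_lineMat_transfer (hpos : ∀ M, IsMinimizer c M → ∀ i j, 0 < M i j)
    {v w : Fin n → ℝ} {i₀ : Fin n} (h : IsMinimizer c (lineMat v w (Pi.single i₀ 1)))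
    {u : ℝ} (hu : 0 < u) (A : Finset (Fin n)) (hA : i₀ ∉ A) (hAu : A.card * u ≤ 1) :
    IsMinimizer c (lineMat v w fun k =>
      if k = i₀ then 1 - A.card * u else if k ∈ A then u else 0) := by
  induction A using Finset.induction with
  | empty =>
    convert h using 2
    funext k
    by_cases hk : k = i₀ <;> simp [hk]
  | insert a A ha ih =>
    rw [Finset.card_insert_of_notMem ha] at hAu ⊢
    push_cast at hAu ⊢
    have hai : i₀ ≠ a := fun h => hA (h ▸ Finset.mem_insert_self _ _)
    have h1 := ih (fun h => hA (Finset.mem_insert_of_mem h)) (by linarith)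
    have hd : 0 < 1 - A.card * u := by linarith
    -- Row `i₀` still carries `1 - A.card * u`, so this fraction moves exactly `u`.
    have h2 := h1.mix (hpos _ h1) (t := u / (1 - A.card * u))
      ⟨by positivity, (div_le_one hd).2 (by linarith)⟩ hai
    rw [mix_lineMat] at h2
    convert h2 using 2
    funext k
    by_cases hk : k = i₀
    · subst hk
      simp only [if_true, Equiv.swap_apply_left, if_neg hai.symm, if_neg ha]
      field_simp
      ring
    · by_cases hka : k = a
      · subst hka
        simp only [if_neg hk, Finset.mem_insert_self, if_true, Equiv.swap_apply_right, if_neg ha]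
        rw [mul_zero, zero_add, div_mul_cancel₀ _ hd.ne']
      · simp only [if_neg hk, Finset.mem_insert, hka, false_or,
          Equiv.swap_apply_of_ne_of_ne hk hka]
        ring

/-- Give `u` to every row except `i` and `j`: those two then differ by a nonzero multiple of `w`, so
the first-order condition applies. -/
lemma rowForm_lineMat_eq_zero (hpos : ∀ M, IsMinimizer c M → ∀ i j, 0 < M i j)
    {v w : Fin n → ℝ} {i j : Fin n} (hij : i ≠ j)
    (h : IsMinimizer c (lineMat v w (Pi.single i 1))) {u : ℝ} (hu : 0 < u) (hu1 : n * u < 1) :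
    rowForm (lineMat v w fun _ => u) i j w w = 0 := by
  set A : Finset (Fin n) := (Finset.univ.erase i).erase j with hA
  have hcard : (A.card : ℝ) * u < 1 := by
    have : (A.card : ℝ) ≤ n := by exact_mod_cast (Finset.card_le_univ A).trans (by simp)
    nlinarith
  have h1 := isMinimizer_lineMat_transfer hpos h hu A (by simp [hA]) hcard.le
  set x : Fin n → ℝ := fun k => if k = i then 1 - A.card * u else if k ∈ A then u else 0 with hx
  have h2 := h1.rowForm_eq_zero (hpos _ h1) hij
  have hd : lineMat v w x i - lineMat v w x j = (1 - A.card * u) • w := by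
    funext l
    simp [lineMat, hx, hij.symm, hA]
  have he : ∀ p q, rowForm (lineMat v w x) i j p q = rowForm (lineMat v w fun _ => u) i j p q := by
    intro p q
    unfold rowForm
    congr 1
    ext k l
    by_cases hj : k = j
    · subst hj; simp
    · rw [Matrix.updateRow_ne hj, Matrix.updateRow_ne hj]
      by_cases hi : k = i
      · subst hi; simp
      · rw [Matrix.updateRow_ne hi, Matrix.updateRow_ne hi]
        simp [lineMat, hx, hi, hA, hj]
  rw [hd, rowForm_smul_left _ hij, rowForm_smul_right, he] at h2
  have hne : (1 - (A.card : ℝ) * u) ≠ 0 := by linarith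
  simpa [hne] using h2

end Minimizers

/-! ### The permanent along a line of rows. -/

section PolynomialRows

open Polynomial

variable {n : ℕ}

lemma derivative_permanent (P : Matrix (Fin n) (Fin n) ℝ[X]) :
    derivative P.permanent = ∑ i, (P.updateRow i fun j => derivative (P i j)).permanent := by
  simp only [permanent_updateRow]
  rw [← Matrix.permanent_transpose, Matrix.permanent, derivative_sum, Finset.sum_comm]
  refine Finset.sum_congr rfl fun σ _ => ?_
  rw [derivative_prod_finset]
  refine Finset.sum_congr rfl fun i _ => ?_
  simp only [Matrix.transpose_apply]
  ring

lemma permanent_map {R S : Type*} [CommSemiring R] [CommSemiring S] (f : R →+* S)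
    (P : Matrix (Fin n) (Fin n) R) : (P.map f).permanent = f P.permanent := by
  simp [Matrix.permanent, map_sum, map_prod]

lemma permanent_equal_rows {R : Type*} [CommSemiring R] (r : Fin n → R) :
    (Matrix.of fun _ : Fin n => r).permanent = n.factorial * ∏ j, r j := by
  simp [Matrix.permanent, Fintype.card_perm]

/-- If the permanent vanishes whenever two rows on the line `v + x • w` are replaced by `w`,
then the product of the coordinates has vanishing second derivative along the line. -/
lemma derivative_derivative_prod_eq_zero {v w : Fin n → ℝ}
    (h : ∀ i j : Fin n, i ≠ j → ∀ u : ℝ, 0 < u → n * u < 1 →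
      rowForm (lineMat v w fun _ => u) i j w w = 0) :
    derivative (derivative (∏ j, (C (v j) + X * C (w j)))) = 0 := by
  set V : Matrix (Fin n) (Fin n) ℝ[X] :=
    lineMat (fun j => C (v j)) (fun j => C (w j)) fun _ => X with hV
  set W : Fin n → ℝ[X] := fun j => C (w j) with hW
  have hdV : ∀ i, (fun j => derivative (V i j)) = W := by
    intro i
    funext j
    simp [hV, hW, lineMat]
  have hzero : ∀ i j, i ≠ j → rowForm V i j W W = 0 := by
    intro i j hij
    -- The condition, known only for small `u > 0`, becomes a polynomial identity.
    refine eq_zero_of_infinite_isRoot _ (Set.Infinite.mono (s := Set.Ioo 0 (1 / ((n : ℝ) + 1))) ?_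
      (Set.Ioo_infinite (by positivity)))
    intro u hu
    have hu1 : n * u < 1 := by
      have := (lt_div_iff₀ (by positivity)).1 hu.2
      nlinarith [hu.1]
    rw [Set.mem_ofPred_eq, IsRoot, ← h i j hij u hu.1 hu1, rowForm, rowForm,
      ← coe_evalRingHom, ← permanent_map]
    congr 1
    ext k l
    by_cases hj : k = j
    · subst hj; simp [hW]
    · rw [Matrix.map_apply, Matrix.updateRow_ne hj, Matrix.updateRow_ne hj]
      by_cases hi : k = i
      · subst hi; simp [hW]
      · rw [Matrix.updateRow_ne hi, Matrix.updateRow_ne hi]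
        simp only [hV, hW, lineMat, Matrix.of_apply, coe_evalRingHom, eval_add, eval_mul,
          eval_C, eval_X]
  have hfac : V.permanent = (n.factorial : ℝ[X]) * ∏ j, (C (v j) + X * C (w j)) :=
    permanent_equal_rows _
  have hdd : derivative (derivative V.permanent) = 0 := by
    rw [derivative_permanent, derivative_sum]
    refine Finset.sum_eq_zero fun i _ => ?_
    rw [hdV, derivative_permanent]
    refine Finset.sum_eq_zero fun j _ => ?_
    by_cases hij : i = j
    · subst hij
      have : (fun l => derivative ((V.updateRow i W) i l)) = 0 := by
        funext l
        simp [hW]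
      rw [this, permanent_updateRow_zero]
    · have : (fun l => derivative ((V.updateRow i W) j l)) = W := by
        rw [← hdV j]
        funext l
        rw [Matrix.updateRow_ne (Ne.symm hij)]
      rw [this]
      exact hzero i j hij
  rw [hfac, derivative_natCast_mul, derivative_natCast_mul] at hdd
  exact (mul_eq_zero.1 hdd).resolve_left (by exact_mod_cast n.factorial_ne_zero)

/-- The degree of the product counts the nonzero `w j`, and a nonzero vector with zero sum has at
least two. -/
lemma eq_zero_of_derivative_derivative_prod_eq_zero {v w : Fin n → ℝ} (hv : ∀ j, 0 < v j)
    (hw : ∑ j, w j = 0) (h : derivative (derivative (∏ j, (C (v j) + X * C (w j)))) = 0) :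
    w = 0 := by
  have hdeg : (∏ j, (C (v j) + X * C (w j))).natDegree ≤ 1 := by
    have h1 := derivative_eq_zero.1 h
    rw [natDegree_derivative] at h1
    omega
  have hne : ∀ j, C (v j) + X * C (w j) ≠ 0 := by
    intro j hj
    have := congr_arg (Polynomial.eval 0) hj
    simp at this
    exact (hv j).ne' this
  rw [natDegree_prod _ _ fun j _ => hne j] at hdeg
  have hfac : ∀ j, w j ≠ 0 → (C (v j) + X * C (w j)).natDegree = 1 := by
    intro j hj
    rw [add_comm, mul_comm]
    exact natDegree_linear hj
  by_contra hw0
  obtain ⟨k, hk⟩ := Function.ne_iff.1 hw0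
  have hl : ∃ l, l ≠ k ∧ w l ≠ 0 := by
    by_contra! hcon
    rw [Finset.sum_eq_single k (fun l _ hl => hcon l hl) (by simp)] at hw
    exact hk hw
  obtain ⟨l, hlk, hl⟩ := hl
  have := Finset.add_le_sum (s := Finset.univ) (f := fun j => (C (v j) + X * C (w j)).natDegree)
    (fun _ _ => Nat.zero_le _) (Finset.mem_univ l) (Finset.mem_univ k) hlk
  simp only [hfac l hl, hfac k hk] at this
  omega

end PolynomialRows

variable {n : ℕ} {c : Fin n → ℝ}

lemma rankOne_mem_Mat (hn : 1 ≤ n) (hc : ∀ j, 0 ≤ c j) (hs : ∑ j, c j = (n : ℝ)) :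
    rankOne c ∈ Mat c := by
  have hn' : (n : ℝ) ≠ 0 := by positivity
  refine ⟨fun i j => ?_, fun i => ?_, fun j => ?_⟩
  · have := hc j
    simp [rankOne]
    positivity
  · simp [rankOne, ← Finset.mul_sum, hs, hn']
  · simp [rankOne, hn']

/-- For each `i`, `N` keeps row `i` of `M`; once all rows of `N` agree, its column sums determine
that row as `c / n`. -/
lemma IsMinimizer.eq_rankOne (hpos : ∀ M, IsMinimizer c M → ∀ i j, 0 < M i j)
    {M : Matrix (Fin n) (Fin n) ℝ} (hM : IsMinimizer c M) : M = rankOne c := by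
  ext i l
  obtain ⟨N, hN, hNi, hNrows⟩ := hM.exists_equal_rows hpos i
  have hall : ∀ k, N k = N i := by
    intro b
    by_cases hbi : b = i
    · rw [hbi]
    have h0 : N = lineMat (N b) (N i - N b) (Pi.single i 1) := by
      ext k l
      by_cases hk : k = i
      · subst hk; simp [lineMat]
      · simp [lineMat, hk, hNrows k b hk hbi]
    have hw : ∑ j, (N i - N b) j = 0 := by simp [hN.1.2.1]
    have hv := hpos N hN b
    suffices N i - N b = 0 from (sub_eq_zero.1 this).symm
    generalize N b = v at h0 hv hw ⊢
    generalize N i - v = w at h0 hw ⊢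
    have hline : ∀ i', IsMinimizer c (lineMat v w (Pi.single i' 1)) := by
      intro i'
      by_cases hi' : i = i'
      · rw [← hi', ← h0]; exact hN
      -- Mixing with `t = 1` swaps the rows, so any row may carry `w`.
      · have h1 := hN.mix (hpos N hN) (t := 1) ⟨zero_le_one, le_rfl⟩ hi'
        rw [h0, mix_lineMat] at h1
        convert h1 using 2
        funext k
        by_cases hk : k = i'
        · subst hk; simp
        · by_cases hki : k = i
          · subst hki; simp [hk, Ne.symm hk]
          · simp [Equiv.swap_apply_of_ne_of_ne hki hk, hk, hki]
    exact eq_zero_of_derivative_derivative_prod_eq_zero hv hw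
      (derivative_derivative_prod_eq_zero fun i' j' hij u hu hu1 =>
        rowForm_lineMat_eq_zero hpos hij (hline i') hu hu1)
  have hcol := hN.1.2.2 l
  simp only [hall, hNi, Finset.sum_const, Finset.card_univ, Fintype.card_fin, nsmul_eq_mul] at hcol
  have hn' : (n : ℝ) ≠ 0 := by
    have := i.pos
    positivity
  simp [rankOne, ← hcol, hn']

/-- If all minimizers are entrywise positive, the rank-one matrix is the unique minimizer. -/
theorem isUniqueMinimizer_of_pos (hn : 1 ≤ n) (hc : ∀ j, 0 ≤ c j) (hs : ∑ j, c j = (n : ℝ))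
    (hpos : ∀ M, IsMinimizer c M → ∀ i j, 0 < M i j) :
    IsUniqueMinimizer Matrix.permanent (Mat c) (rankOne c) := by
  have hmem := rankOne_mem_Mat hn hc hs
  obtain ⟨M, hM, hmin⟩ := (isCompact_Mat c).exists_isMinOn ⟨_, hmem⟩
    continuous_permanent.continuousOn
  have h : IsMinimizer c M := ⟨hM, hmin⟩
  have e := h.eq_rankOne hpos
  refine ⟨hmem, e ▸ hmin, fun b hb hbm => IsMinimizer.eq_rankOne hpos ⟨hb, hbm⟩⟩

end PermMin

/-! ### Excluding zero entries, and the conclusion. -/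

namespace PermMin

lemma permanent_rankOne {n : ℕ} (c : Fin n → ℝ) :
    (rankOne c).permanent = (n.factorial : ℝ) / (n : ℝ) ^ n * ∏ j, c j := by
  have e : rankOne c = Matrix.of fun _ : Fin n => fun j => 1 / (n : ℝ) * c j := by
    ext i j
    simp [rankOne]
  rw [e, permanent_equal_rows, Finset.prod_mul_distrib, Finset.prod_const, Finset.card_univ,
    Fintype.card_fin, one_div, inv_pow]
  ring

/-- With `r = (m + 1) / (m + 2)`, divide by `r ^ m`; Bernoulli gives `(1 - 1 / (m + 1)^2)^m ≥ 1 - m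
/ (m + 1)^2 > r`. -/
lemma capFactor_strictAnti (m : ℕ) : capFactor (m + 2) < capFactor (m + 1) := by
  unfold capFactor
  have e1 : (((m + 2 : ℕ) : ℝ) - 1) / ((m + 2 : ℕ) : ℝ) = ((m : ℝ) + 1) / (m + 2) := by
    push_cast; ring
  have e2 : (((m + 1 : ℕ) : ℝ) - 1) / ((m + 1 : ℕ) : ℝ) =
      ((m : ℝ) + 1) / (m + 2) * (1 + -(1 / ((m : ℝ) + 1) ^ 2)) := by
    push_cast; field_simp; ring
  rw [e1, e2, show m + 2 - 1 = m + 1 from rfl, show m + 1 - 1 = m from rfl, mul_pow, pow_succ]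
  have hb : (-2 : ℝ) ≤ -(1 / ((m : ℝ) + 1) ^ 2) := by
    have : 1 / ((m : ℝ) + 1) ^ 2 ≤ 1 := by
      rw [div_le_one (by positivity)]
      nlinarith [(m.cast_nonneg : (0 : ℝ) ≤ m)]
    linarith
  refine mul_lt_mul_of_pos_left (lt_of_lt_of_le ?_ (one_add_mul_le_pow hb m)) (by positivity)
  have : (1 : ℝ) + m * -(1 / ((m : ℝ) + 1) ^ 2) - ((m : ℝ) + 1) / (m + 2) =
      1 / (((m : ℝ) + 1) ^ 2 * (m + 2)) := by
    field_simp; ring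
  have h2 : (0 : ℝ) < 1 / (((m : ℝ) + 1) ^ 2 * (m + 2)) := by positivity
  linarith

/-- The capacity of a doubly stochastic matrix is at least `1`. -/
lemma prod_le_of_doubly_stochastic {n : ℕ} {M : Matrix (Fin n) (Fin n) ℝ}
    (h0 : ∀ i j, 0 ≤ M i j) (hr : ∀ i, ∑ j, M i j = 1) (hc : ∀ j, ∑ i, M i j = 1)
    {x : Fin n → ℝ} (hx : ∀ i, 0 < x i) : ∏ i, x i ≤ ∏ i, ∑ j, M i j * x j := by
  -- Column sums 1 split each `x j` over the rows; row sums 1 allow weighted AM-GM in each row.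
  calc ∏ j, x j = ∏ j, ∏ i, x j ^ M i j := by
        refine Finset.prod_congr rfl fun j _ => ?_
        rw [← Real.rpow_sum_of_pos (hx j), hc, Real.rpow_one]
    _ = ∏ i, ∏ j, x j ^ M i j := Finset.prod_comm
    _ ≤ _ := Finset.prod_le_prod
        (fun i _ => Finset.prod_nonneg fun j _ => Real.rpow_nonneg (hx j).le _)
        fun i _ => Real.geom_mean_le_arith_mean_weighted _ _ _ (fun j _ => h0 i j) (hr i)
          fun j _ => (hx j).le

lemma lt_permanent_of_doubly_stochastic {n : ℕ} {M : Matrix (Fin n) (Fin n) ℝ}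
    (h0 : ∀ i j, 0 ≤ M i j) (hr : ∀ i, ∑ j, M i j = 1) (hc : ∀ j, ∑ i, M i j = 1)
    {i₀ j₀ : Fin n} (hz : M i₀ j₀ = 0) :
    (n.factorial : ℝ) / (n : ℝ) ^ n < M.permanent := by
  rcases n with _ | _ | m
  · exact i₀.elim0
  · have h1 := hr i₀
    have : Subsingleton (Fin (0 + 1)) := inferInstanceAs (Subsingleton (Fin 1))
    rw [Fintype.sum_subsingleton _ j₀, hz] at h1
    exact absurd h1 zero_ne_one
  · have h1 := le_permanent_of_entry_zero hz h0 one_pos fun x hx => by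
      rw [one_mul]
      exact prod_le_of_doubly_stochastic h0 hr hc hx
    rw [mul_one] at h1
    have e : ((m + 1 + 1 : ℕ) : ℝ) = (m : ℝ) + 2 := by push_cast; ring
    rw [e, ← capFactor_mul_factorial]
    exact lt_of_lt_of_le (mul_lt_mul_of_pos_right (capFactor_strictAnti m) (by positivity)) h1

/-- A lower bound on the capacity bounds the polynomial from below. -/
lemma mul_prod_le_of_le_capacity {n : ℕ} {M : Matrix (Fin n) (Fin n) ℝ} (h0 : ∀ i j, 0 ≤ M i j)
    {L : ℝ} (hL : L ≤ capacity 1 (assocPoly M)) {x : Fin n → ℝ} (hx : ∀ i, 0 < x i) :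
    L * ∏ i, x i ≤ ∏ i, ∑ j, M i j * x j := by
  have hbdd : BddBelow (Set.range fun x : {x : Fin n → ℝ // ∀ i, 0 < x i} =>
      MvPolynomial.eval x.1 (assocPoly M) / ∏ i, x.1 i ^ (1 : Fin n → ℕ) i) := by
    refine ⟨0, ?_⟩
    rintro _ ⟨y, rfl⟩
    change 0 ≤ MvPolynomial.eval y.1 (rowProduct M) / _
    rw [eval_rowProduct]
    exact div_nonneg (Finset.prod_nonneg fun i _ => Finset.sum_nonneg fun j _ =>
      mul_nonneg (h0 i j) (y.2 j).le) (Finset.prod_nonneg fun i _ => pow_nonneg (y.2 i).le _)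
  have h1 := hL.trans (ciInf_le hbdd ⟨x, hx⟩)
  change L ≤ MvPolynomial.eval x (rowProduct M) / _ at h1
  rw [eval_rowProduct] at h1
  simp only [Pi.one_apply, pow_one] at h1
  exact (le_div_iff₀ (Finset.prod_pos fun i _ => hx i)).1 h1

/-- Row-stochastic matrices with a vanishing entry and small permanent have column sums bounded
away from `1`. -/
lemma exists_gap (n : ℕ) : ∃ ε : ℝ, 0 < ε ∧ ∀ M : Matrix (Fin n) (Fin n) ℝ,
    (∀ i j, 0 ≤ M i j) → (∀ i, ∑ j, M i j = 1) → (∃ i j, M i j = 0) →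
    M.permanent ≤ (n.factorial : ℝ) / (n : ℝ) ^ n * ∏ j, ∑ i, M i j →
    ε ≤ ∑ j, |∑ i, M i j - 1| := by
  -- A zero entry is encoded as a vanishing product of all entries, a closed condition.
  let K : Set (Matrix (Fin n) (Fin n) ℝ) :=
    {M | ∀ i j, M i j ∈ Set.Icc (0 : ℝ) 1} ∩ ({M | ∀ i, ∑ j, M i j = 1} ∩
      ({M | ∏ i, ∏ j, M i j = 0} ∩
        {M | M.permanent ≤ (n.factorial : ℝ) / (n : ℝ) ^ n * ∏ j, ∑ i, M i j}))
  have hcol : ∀ j, Continuous fun M : Matrix (Fin n) (Fin n) ℝ => ∑ i, M i j := fun j =>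
    continuous_finsetSum _ fun i _ => continuous_entry i j
  have hK : IsCompact K := by
    refine isCompact_unit_matrices.inter_right (IsClosed.inter ?_ (IsClosed.inter ?_ ?_))
    · rw [Set.ofPred_forall]
      exact isClosed_iInter fun i => isClosed_eq
        (continuous_finsetSum _ fun j _ => continuous_entry i j) continuous_const
    · exact isClosed_eq (continuous_finsetProd _ fun i _ => continuous_finsetProd _ fun j _ =>
        continuous_entry i j) continuous_const
    · exact isClosed_le continuous_permanent
        (continuous_const.mul (continuous_finsetProd _ fun j _ => hcol j))
  have hmem : ∀ M : Matrix (Fin n) (Fin n) ℝ, (∀ i j, 0 ≤ M i j) → (∀ i, ∑ j, M i j = 1) →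
      (∃ i j, M i j = 0) → M.permanent ≤ (n.factorial : ℝ) / (n : ℝ) ^ n * ∏ j, ∑ i, M i j →
      M ∈ K := by
    rintro M h0 hr ⟨i, j, hij⟩ hp
    exact ⟨mem_Icc_of_row_sum h0 hr, hr, Finset.prod_eq_zero (Finset.mem_univ i)
      (Finset.prod_eq_zero (Finset.mem_univ j) hij), hp⟩
  rcases K.eq_empty_or_nonempty with hE | hne
  · exact ⟨1, one_pos, fun M h0 hr hz hp => absurd (hmem M h0 hr hz hp) (by simp [hE])⟩
  obtain ⟨A, hAK, hA⟩ := hK.exists_isMinOn hne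
    (f := fun M : Matrix (Fin n) (Fin n) ℝ => ∑ j, |∑ i, M i j - 1|)
    (Continuous.continuousOn (continuous_finsetSum _ fun j _ =>
      ((hcol j).sub continuous_const).abs))
  refine ⟨∑ j, |∑ i, A i j - 1|, ?_, fun M h0 hr hz hp => hA (hmem M h0 hr hz hp)⟩
  -- A distance of zero would make `A` doubly stochastic with a zero entry, whose permanent exceeds
  -- `n!/n^n`.
  refine lt_of_le_of_ne (Finset.sum_nonneg fun j _ => abs_nonneg _) fun hzero => ?_
  have hone : ∀ j, ∑ i, A i j = 1 := fun j => by
    have := (Finset.sum_eq_zero_iff_of_nonneg fun j _ => abs_nonneg _).1 hzero.symm j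
      (Finset.mem_univ j)
    exact sub_eq_zero.1 (abs_eq_zero.1 this)
  have hr : ∀ i, ∑ j, A i j = 1 := hAK.2.1
  have hprod : ∏ i, ∏ j, A i j = 0 := hAK.2.2.1
  have hp : A.permanent ≤ (n.factorial : ℝ) / (n : ℝ) ^ n * ∏ j, ∑ i, A i j := hAK.2.2.2
  obtain ⟨i, -, hi⟩ := Finset.prod_eq_zero_iff.1 hprod
  obtain ⟨j, -, hij⟩ := Finset.prod_eq_zero_iff.1 hi
  simp only [hone, Finset.prod_const_one, mul_one] at hp
  exact absurd hp (not_le.2 (lt_permanent_of_doubly_stochastic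
    (fun i j => (hAK.1 i j).1) hr hone hij))

end PermMin

theorem mainTheorem9 (n : ℕ) (hn : 1 ≤ n) :
    (∃ ε : ℝ, 0 < ε ∧ ∀ c : Fin n → ℝ, (∀ j, 0 ≤ c j) → ∑ j, c j = (n : ℝ) →
      ∑ j, |c j - 1| < ε →
        PermMin.IsUniqueMinimizer Matrix.permanent (PermMin.Mat c) (PermMin.rankOne c)) ∧
    (2 ≤ n → ∀ c : Fin n → ℝ, (∀ j, 0 ≤ c j) → ∑ j, c j = (n : ℝ) →
      ∀ L : ℝ, 0 < L → (∀ M ∈ PermMin.Mat c, L ≤ PermMin.capacity 1 (PermMin.assocPoly M)) →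
        (∏ j, c j) / L <
          ((n : ℝ) - 2) ^ (n - 2) * (n : ℝ) ^ (n - 1) / ((n : ℝ) - 1) ^ (2 * n - 3) →
        PermMin.IsUniqueMinimizer Matrix.permanent (PermMin.Mat c) (PermMin.rankOne c)) := by
  have hperm : ∀ c : Fin n → ℝ, (∀ j, 0 ≤ c j) → ∑ j, c j = (n : ℝ) →
      ∀ M, PermMin.IsMinimizer c M →
        M.permanent ≤ (n.factorial : ℝ) / (n : ℝ) ^ n * ∏ j, c j := by
    intro c hc hs M hM
    rw [← PermMin.permanent_rankOne]
    exact hM.2 (PermMin.rankOne_mem_Mat hn hc hs)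
  constructor
  · obtain ⟨ε, hε, h⟩ := PermMin.exists_gap n
    refine ⟨ε, hε, fun c hc hs hd => PermMin.isUniqueMinimizer_of_pos hn hc hs fun M hM i j => ?_⟩
    refine lt_of_le_of_ne (hM.1.1 i j) fun hij => ?_
    have := h M hM.1.1 hM.1.2.1 ⟨i, j, hij.symm⟩ (by
      simpa only [hM.1.2.2] using hperm c hc hs M hM)
    simp only [hM.1.2.2] at this
    linarith
  · intro hn2 c hc hs L hL hcap hlt
    refine PermMin.isUniqueMinimizer_of_pos hn hc hs fun M hM i j => ?_
    refine lt_of_le_of_ne (hM.1.1 i j) fun hij => ?_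
    have hle := hperm c hc hs M hM
    obtain ⟨m, rfl⟩ : ∃ m, n = m + 2 := ⟨n - 2, by omega⟩
    have hge := PermMin.le_permanent_of_entry_zero hij.symm hM.1.1 hL fun x hx =>
      PermMin.mul_prod_le_of_le_capacity hM.1.1 (hcap M hM.1) hx
    have e1 : ((m + 2 : ℕ) : ℝ) - 2 = m := by push_cast; ring
    have e2 : ((m + 2 : ℕ) : ℝ) - 1 = (m : ℝ) + 1 := by push_cast; ring
    rw [e1, e2, show m + 2 - 2 = m from rfl, show m + 2 - 1 = m + 1 from rfl,
      show 2 * (m + 2) - 3 = m + (m + 1) by omega, div_lt_iff₀ hL] at hlt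
    have hpos : (0 : ℝ) < ((m + 2).factorial : ℝ) / ((m + 2 : ℕ) : ℝ) ^ (m + 2) := by positivity
    have h3 := mul_lt_mul_of_pos_left hlt hpos
    -- The constant in the hypothesis is the ratio of the zero-entry constant to `n!/n^n`, with `n =
    -- m + 2`.
    have e3 : ((m + 2).factorial : ℝ) / ((m + 2 : ℕ) : ℝ) ^ (m + 2) *
        ((m : ℝ) ^ m * ((m + 2 : ℕ) : ℝ) ^ (m + 1) / ((m : ℝ) + 1) ^ (m + (m + 1)) * L) =
        PermMin.capFactor (m + 1) * (((m + 1).factorial : ℝ) / ((m : ℝ) + 1) ^ (m + 1)) * L := by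
      unfold PermMin.capFactor
      have e4 : ((m + 1 : ℕ) : ℝ) - 1 = m := by push_cast; ring
      rw [e4, show m + 1 - 1 = m from rfl, div_pow, Nat.factorial_succ (m + 1),
        pow_add ((m : ℝ) + 1), pow_succ ((m + 2 : ℕ) : ℝ) (m + 1)]
      push_cast
      have : (m : ℝ) + 2 ≠ 0 := by positivity
      have : (m : ℝ) + 1 ≠ 0 := by positivity
      field_simp
      ring
    rw [e3] at h3
    linarith
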